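/- Let $\mathcal{E}$ be an elementary topos satisfying the Nullstellensatz (NS): every object of $\mathcal{E}$ is either initial or has a global element. For an object $X$ let $P_c(X)=\{u\in P(X): u\cup u^c=X\}\rightarrowtail P(X)$ be the object of complemented parts of $X$, where $u^c=\{x\in X: x\notin u\}$. A map $f:X\to Y$ is said to have *pneumoconnected fibers* if the formula $$\neg\neg\bigl(f^{-1}(y)\cap w=\varnothing\ \vee\ f^{-1}(y)\cap w^c=\varnothing\bigr),\qquad y\in Y,\ w\in P_c(X),$$ of the internal language of $\mathcal{E}$ is universally valid, where $f^{-1}(y)=\{x\in X:\langle x,y\rangle\in|f|\}$ and $|f|\rightarrowtail X\times Y$ is the graph of $f$. Let $X$ be an object of $\mathcal{E}$. 1. The reflection $m_{\neg\neg}^X:X\to M_{\neg\neg}X$ of $X$ in the full subcategory of $\neg\neg$-separated objects (the universal map from $X$ to a $\neg\neg$-separated object) has pneumoconnected fibers. 2. Consequently, the unit $X\to a_{\neg\neg}X$ of $\neg\neg$-sheafification (the universal map from $X$ to a $\neg\neg$-sheaf) has pneumoconnected fibers. -/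

import Mathlib

open CategoryTheory Limits MonoidalCategory CartesianMonoidalCategory

universe v u

/-! Throughout, an elementary topos is a category with finite limits (with chosen finite products),
which is cartesian closed and has a subobject classifier `Ω`. A formula of the internal language in
the context `Γ` is interpreted as an arrow `Γ ⟶ Ω`, and a term of type `A` in the context `Γ` as an
arrow `Γ ⟶ A`. Quantification over `A` takes a formula in the context `A ⊗ Γ` to one in `Γ`. -/

namespace Topos

noncomputable section

open HasSubobjectClassifier

/-- The Nullstellensatz (NS): any object is either initial or has a global element. -/
def Nullstellensatz (E : Type u) [Category.{v} E] [CartesianMonoidalCategory E] : Prop :=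
  ∀ X : E, Nonempty (IsInitial X) ∨ Nonempty (𝟙_ E ⟶ X)

variable {E : Type u} [Category.{v} E] [CartesianMonoidalCategory E] [HasSubobjectClassifier E]

/-! ### The internal language -/

section Logic

/-- The true formula in the context `Γ`, that is `Γ ⟶ 1 ⟶ Ω`. -/
def top (Γ : E) : Γ ⟶ Ω E := Subobject.Classifier.χ₀ _ Γ ≫ truth E

/-- A formula is universally valid if its interpretation is the true arrow, i.e. if the subobject
of the context that it classifies is everything. -/
def UniversallyValid {Γ : E} (φ : Γ ⟶ Ω E) : Prop := φ = top Γ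

instance mono_lift_id {A B : E} (f : A ⟶ B) : Mono (lift (𝟙 A) f) :=
  mono_of_mono_fac (lift_fst (𝟙 A) f)

instance mono_from_unit {A : E} (a : 𝟙_ E ⟶ A) : Mono a :=
  ⟨fun _ _ _ => toUnit_unique _ _⟩

/-- Equality of two terms of type `A`: the diagonal of `A` is classified by `=_A : A ⊗ A ⟶ Ω`. -/
def eq {Γ A : E} (s t : Γ ⟶ A) : Γ ⟶ Ω E := lift s t ≫ χ (lift (𝟙 A) (𝟙 A))

/-- Conjunction; `∧ : Ω ⊗ Ω ⟶ Ω` classifies `⟨true, true⟩ : 1 ⟶ Ω ⊗ Ω`. -/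
def and {Γ : E} (φ ψ : Γ ⟶ Ω E) : Γ ⟶ Ω E :=
  lift φ ψ ≫ χ (lift (top (𝟙_ E)) (top (𝟙_ E)))

/-- Implication; `⇒ : Ω ⊗ Ω ⟶ Ω` classifies the order relation of `Ω`, i.e. the equalizer of `∧`
and the first projection. -/
def imp {Γ : E} (φ ψ : Γ ⟶ Ω E) : Γ ⟶ Ω E := eq (and φ ψ) φ

variable [MonoidalClosed E]

/-- The universal quantifier; `∀_A : Ω ^ A ⟶ Ω` classifies the name `1 ⟶ Ω ^ A` of the true
arrow of `A`. -/
def all {Γ A : E} (φ : A ⊗ Γ ⟶ Ω E) : Γ ⟶ Ω E :=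
  MonoidalClosed.curry φ ≫ χ (MonoidalClosed.curry (top (A ⊗ 𝟙_ E)))

/-- The false formula, `∀ ω ∈ Ω, ω`. -/
def bot (Γ : E) : Γ ⟶ Ω E := all (fst (Ω E) Γ)

/-- Negation, `φ ⇒ ⊥`. -/
def not {Γ : E} (φ : Γ ⟶ Ω E) : Γ ⟶ Ω E := imp φ (bot Γ)

/-- Disjunction, `∀ ω ∈ Ω, ((φ ⇒ ω) ∧ (ψ ⇒ ω)) ⇒ ω`: the least upper bound of `φ` and `ψ`. -/
def or {Γ : E} (φ ψ : Γ ⟶ Ω E) : Γ ⟶ Ω E :=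
  all (imp (and (imp (snd (Ω E) Γ ≫ φ) (fst (Ω E) Γ)) (imp (snd (Ω E) Γ ≫ ψ) (fst (Ω E) Γ)))
    (fst (Ω E) Γ))

end Logic

/-! ### Power objects and set-theoretic terms -/

section Power

variable [MonoidalClosed E]

/-- The power object `P(X) = Ω ^ X`. -/
abbrev power (X : E) : E := (ihom X).obj (Ω E)

/-- The formula `x ∈ u` in the context `x ∈ X`, `Γ`, for a term `u` of type `P(X)`. -/
def mem {Γ X : E} (u : Γ ⟶ power X) : X ⊗ Γ ⟶ Ω E := MonoidalClosed.uncurry u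

/-- The term `{x ∈ X : φ}` of type `P(X)`. -/
def compr {Γ X : E} (φ : X ⊗ Γ ⟶ Ω E) : Γ ⟶ power X := MonoidalClosed.curry φ

/-- The term `∅` of type `P(X)`. -/
def empty (Γ X : E) : Γ ⟶ power X := compr (bot (X ⊗ Γ))

/-- The term `X` of type `P(X)`. -/
def whole (Γ X : E) : Γ ⟶ power X := compr (top (X ⊗ Γ))

/-- The term `u ∩ v`. -/
def inter {Γ X : E} (u v : Γ ⟶ power X) : Γ ⟶ power X := compr (and (mem u) (mem v))

/-- The term `u ∪ v`. -/
def union {Γ X : E} (u v : Γ ⟶ power X) : Γ ⟶ power X := compr (or (mem u) (mem v))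

/-- The term `uᶜ = {x ∈ X : x ∉ u}`. -/
def compl {Γ X : E} (u : Γ ⟶ power X) : Γ ⟶ power X := compr (not (mem u))

variable [HasFiniteLimits E]

/-- The object `P_c(X) = {u ∈ P(X) : u ∪ uᶜ = X}` of complemented parts of `X`. -/
def complPower (X : E) : E :=
  equalizer (union (𝟙 (power X)) (compl (𝟙 (power X)))) (whole (power X) X)

/-- The inclusion of `P_c(X)` in `P(X)`. -/
def complPowerι (X : E) : complPower X ⟶ power X := equalizer.ι _ _

end Power

/-! ### Maps with pneumoconnected fibers -/

section Pneumoconnected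

variable [MonoidalClosed E]

/-- The formula `⟨x, y⟩ ∈ |f|`, classifying the graph `⟨1, f⟩ : X ⟶ X ⊗ Y` of `f`. -/
def graph {X Y : E} (f : X ⟶ Y) : X ⊗ Y ⟶ Ω E := χ (lift (𝟙 X) f)

/-- The term `f⁻¹(y) = {x ∈ X : ⟨x, y⟩ ∈ |f|}` of type `P(X)`, in the context `y ∈ Y`. -/
def fiber {X Y : E} (f : X ⟶ Y) : Y ⟶ power X := compr (graph f)

variable [HasFiniteLimits E]

/-- A map `f : X ⟶ Y` has pneumoconnected fibers if the formula
`¬¬(f⁻¹(y) ∩ w = ∅ ∨ f⁻¹(y) ∩ wᶜ = ∅)`, with `y ∈ Y` and `w ∈ P_c(X)`, is universally valid. -/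
def HasPneumoconnectedFibers {X Y : E} (f : X ⟶ Y) : Prop :=
  let Γ : E := Y ⊗ complPower X
  let f_inv_y : Γ ⟶ power X := fst Y (complPower X) ≫ fiber f
  let w : Γ ⟶ power X := snd Y (complPower X) ≫ complPowerι X
  UniversallyValid
    (not (not (or (eq (inter f_inv_y w) (empty Γ X)) (eq (inter f_inv_y (compl w)) (empty Γ X)))))

end Pneumoconnected

/-! ### Separated objects and sheaves for the double negation -/

section Sheaves

/-- A monomorphism `m : A ⟶ B` is dense for `j : Ω ⟶ Ω` if its `j`-closure, the subobject of `B`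
classified by `j ∘ χ m`, is all of `B`. -/
def IsDenseMono (j : Ω E ⟶ Ω E) {A B : E} (m : A ⟶ B) [Mono m] : Prop :=
  χ m ≫ j = top B

/-- `F` is `j`-separated: every map to `F` from a `j`-dense subobject has at most one extension. -/
def IsSeparatedFor (j : Ω E ⟶ Ω E) : ObjectProperty E := fun F =>
  ∀ ⦃A B : E⦄ (m : A ⟶ B) [Mono m], IsDenseMono j m →
    ∀ g h : B ⟶ F, m ≫ g = m ≫ h → g = h

/-- `F` is a `j`-sheaf: every map to `F` from a `j`-dense subobject has exactly one extension. -/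
def IsSheafFor (j : Ω E ⟶ Ω E) : ObjectProperty E := fun F =>
  ∀ ⦃A B : E⦄ (m : A ⟶ B) [Mono m], IsDenseMono j m →
    ∀ a : A ⟶ F, ∃! g : B ⟶ F, m ≫ g = a

/-- The double negation operator `¬¬ : Ω ⟶ Ω`. -/
def notNot (E : Type u) [Category.{v} E] [CartesianMonoidalCategory E] [HasSubobjectClassifier E]
    [MonoidalClosed E] : Ω E ⟶ Ω E := not (not (𝟙 (Ω E)))

/-- `m : X ⟶ M` is a reflection of `X` in the full subcategory of the objects that satisfy `P`, that
is, a component of the unit of the reflection: `M` satisfies `P`, and every map from `X` to an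
object that satisfies `P` factors uniquely through `m`. -/
def IsReflection (P : ObjectProperty E) {X M : E} (m : X ⟶ M) : Prop :=
  P M ∧ ∀ ⦃Z : E⦄, P Z → ∀ f : X ⟶ Z, ∃! g : M ⟶ Z, m ≫ g = f

end Sheaves

end

end Topos

namespace Topos

open HasSubobjectClassifier

/-! ### Formulas as classifiers of subobjects -/

section Subobjects

variable {E : Type u} [Category.{v} E] [HasSubobjectClassifier E]

/-! A complemented part of `X` is `¬¬`-stable, so at a global parameter it amounts to a map from `X`
to the object `stableΩ` of `¬¬`-stable truth values. That object is a `¬¬`-sheaf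
(`isSheafFor_stableΩ`), hence also separated, so the map factors through either reflection of `X`
and is constant on its fibers.

NS turns this into the internal statement. By `exists_point_or_not_valid`, `¬¬ψ` is valid unless
`¬ψ` holds at a global element. At such a point neither of the two intersections is empty, so NS
gives each a global element (`eq_empty_valid_or_exists_mem`): two points of one fiber, one in `w`
and one in its complement, which contradicts constancy. -/

@[simp]
lemma comp_top {T Γ : E} (t : T ⟶ Γ) : t ≫ top Γ = top T := by
  unfold top
  rw [← Category.assoc]
  congr 1
  exact Subsingleton.elim _ _

lemma isSeparatedFor_of_isSheafFor {j : Ω E ⟶ Ω E} {F : E} (hF : IsSheafFor j F) :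
    IsSeparatedFor j F :=
  fun _ _ m _ hm _ h hgh => (hF m hm (m ≫ h)).unique hgh rfl

lemma comp_χ_eq_top_iff {T A B : E} (m : A ⟶ B) [Mono m] (t : T ⟶ B) :
    t ≫ χ m = top T ↔ ∃ k, k ≫ m = t := by
  constructor
  · intro h
    exact ⟨(isPullback_χ m).lift t _ h, (isPullback_χ m).lift_fst _ _ _⟩
  · rintro ⟨k, rfl⟩
    rw [Category.assoc, HasSubobjectClassifier.comm, ← comp_top k]
    rfl

variable [HasPullbacks E]

/-- Two formulas which hold at the same generalized elements are equal. -/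
lemma formula_ext {Γ : E} {φ ψ : Γ ⟶ Ω E}
    (h : ∀ ⦃T : E⦄ (t : T ⟶ Γ), t ≫ φ = top T ↔ t ≫ ψ = top T) : φ = ψ := by
  obtain ⟨A, m, _, hm⟩ := Subobject.Classifier.surjective_χ _ φ
  obtain ⟨B, n, _, hn⟩ := Subobject.Classifier.surjective_χ _ ψ
  change φ = χ m at hm
  change ψ = χ n at hn
  subst hm hn
  have h' : ∀ ⦃T : E⦄ (t : T ⟶ Γ), (∃ k, k ≫ m = t) ↔ ∃ k, k ≫ n = t := fun T t => by
    rw [← comp_χ_eq_top_iff, ← comp_χ_eq_top_iff, h]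
  obtain ⟨k, hk⟩ := (h' m).1 ⟨𝟙 _, by simp⟩
  obtain ⟨l, hl⟩ := (h' n).2 ⟨𝟙 _, by simp⟩
  refine unique n _ (IsPullback.of_iso (isPullback_χ m) ⟨k, l, ?_, ?_⟩ (Iso.refl _)
    (Iso.refl _) (Iso.refl _) ?_ (Subsingleton.elim _ _) ?_ ?_)
  · rw [← cancel_mono m]; simp [hk, hl]
  · rw [← cancel_mono n]; simp [hk, hl]
  · simpa using hk.symm
  · simp
  · simp

/-- Every formula extends along a monomorphism. -/
lemma exists_extension_of_mono {A B : E} (m : A ⟶ B) [Mono m] (φ : A ⟶ Ω E) :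
    ∃ ψ : B ⟶ Ω E, m ≫ ψ = φ := by
  obtain ⟨U, i, _, rfl⟩ : ∃ (U : E) (i : U ⟶ A) (_ : Mono i), φ = χ i :=
    Subobject.Classifier.surjective_χ _ φ
  -- The part classified by `φ`, regarded as a part of `B`; since `m` is monic, pulling it back
  -- along `m` returns the original.
  refine ⟨χ (i ≫ m), formula_ext fun T t => ?_⟩
  rw [← Category.assoc, comp_χ_eq_top_iff, comp_χ_eq_top_iff]
  simp only [← Category.assoc, cancel_mono]

end Subobjects

/-! ### Kripke–Joyal semantics of equality, conjunction and implication -/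

section Semantics

variable {E : Type u} [Category.{v} E] [CartesianMonoidalCategory E] [HasSubobjectClassifier E]

lemma eq_valid_iff {Γ A : E} (s t : Γ ⟶ A) : eq s t = top Γ ↔ s = t := by
  unfold eq
  rw [comp_χ_eq_top_iff]
  constructor
  · rintro ⟨k, h⟩
    have h₁ := congrArg (· ≫ fst _ _) h
    have h₂ := congrArg (· ≫ snd _ _) h
    simp at h₁ h₂
    exact h₁.symm.trans h₂
  · rintro rfl
    exact ⟨s, by simp⟩

lemma and_valid_iff {Γ : E} (φ ψ : Γ ⟶ Ω E) : and φ ψ = top Γ ↔ φ = top Γ ∧ ψ = top Γ := by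
  unfold and
  rw [comp_χ_eq_top_iff]
  constructor
  · rintro ⟨k, h⟩
    have h₁ := congrArg (· ≫ fst _ _) h
    have h₂ := congrArg (· ≫ snd _ _) h
    simp at h₁ h₂
    exact ⟨h₁.symm, h₂.symm⟩
  · rintro ⟨rfl, rfl⟩
    exact ⟨toUnit Γ, by simp⟩

@[simp]
lemma comp_eq {T Γ A : E} (t : T ⟶ Γ) (a b : Γ ⟶ A) : t ≫ eq a b = eq (t ≫ a) (t ≫ b) := by
  rw [eq, eq, ← Category.assoc, comp_lift]

@[simp]
lemma comp_and {T Γ : E} (t : T ⟶ Γ) (φ ψ : Γ ⟶ Ω E) :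
    t ≫ and φ ψ = and (t ≫ φ) (t ≫ ψ) := by
  rw [and, and, ← Category.assoc, comp_lift]

@[simp]
lemma comp_imp {T Γ : E} (t : T ⟶ Γ) (φ ψ : Γ ⟶ Ω E) :
    t ≫ imp φ ψ = imp (t ≫ φ) (t ≫ ψ) := by
  simp [imp]

variable [HasFiniteLimits E]

lemma imp_valid_iff {Γ : E} (φ ψ : Γ ⟶ Ω E) :
    imp φ ψ = top Γ ↔ ∀ ⦃T : E⦄ (t : T ⟶ Γ), t ≫ φ = top T → t ≫ ψ = top T := by
  unfold imp
  rw [eq_valid_iff]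
  constructor
  · intro h T t ht
    rw [← h, comp_and, and_valid_iff] at ht
    exact ht.2
  · intro h
    refine formula_ext fun T t => ?_
    rw [comp_and, and_valid_iff]
    exact ⟨fun h' => h'.1, fun h' => ⟨h', h t h'⟩⟩

end Semantics

/-! ### Quantifiers, negation, disjunction and membership: substitution and semantics -/

section ClosedSemantics

variable {E : Type u} [Category.{v} E] [CartesianMonoidalCategory E] [HasSubobjectClassifier E]
  [MonoidalClosed E]

@[simp]
lemma comp_compr {T Γ X : E} (t : T ⟶ Γ) (φ : X ⊗ Γ ⟶ Ω E) :
    t ≫ compr φ = compr (X ◁ t ≫ φ) :=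
  (MonoidalClosed.curry_natural_left _ _).symm

lemma mem_comp {T Γ X : E} (t : T ⟶ Γ) (u : Γ ⟶ power X) : mem (t ≫ u) = X ◁ t ≫ mem u :=
  MonoidalClosed.uncurry_natural_left _ _

@[simp]
lemma mem_compr {Γ X : E} (φ : X ⊗ Γ ⟶ Ω E) : mem (compr φ) = φ :=
  MonoidalClosed.uncurry_curry φ

@[simp]
lemma compr_mem {Γ X : E} (u : Γ ⟶ power X) : compr (mem u) = u :=
  MonoidalClosed.curry_uncurry u

lemma all_valid_iff {Γ A : E} (φ : A ⊗ Γ ⟶ Ω E) : all φ = top Γ ↔ φ = top (A ⊗ Γ) := by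
  unfold all
  rw [comp_χ_eq_top_iff]
  have key (k : Γ ⟶ 𝟙_ E) :
      k ≫ MonoidalClosed.curry (top (A ⊗ 𝟙_ E)) = MonoidalClosed.curry (top (A ⊗ Γ)) := by
    rw [← MonoidalClosed.curry_natural_left, comp_top]
  constructor
  · rintro ⟨k, h⟩
    rw [key] at h
    exact (MonoidalClosed.curry_injective h).symm
  · rintro rfl
    exact ⟨toUnit Γ, key _⟩

@[simp]
lemma comp_all {T Γ A : E} (t : T ⟶ Γ) (φ : A ⊗ Γ ⟶ Ω E) : t ≫ all φ = all (A ◁ t ≫ φ) := by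
  simp [all, MonoidalClosed.curry_natural_left]

@[simp]
lemma comp_bot {T Γ : E} (t : T ⟶ Γ) : t ≫ bot Γ = bot T := by
  simp [bot]

@[simp]
lemma comp_not {T Γ : E} (t : T ⟶ Γ) (φ : Γ ⟶ Ω E) : t ≫ not φ = not (t ≫ φ) := by
  simp [not]

@[simp]
lemma comp_or {T Γ : E} (t : T ⟶ Γ) (φ ψ : Γ ⟶ Ω E) : t ≫ or φ ψ = or (t ≫ φ) (t ≫ ψ) := by
  simp [or]

@[simp]
lemma comp_notNot {Γ : E} (φ : Γ ⟶ Ω E) : φ ≫ notNot E = not (not φ) := by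
  simp [notNot]

lemma lift_comp_mem_fiber_valid_iff {T X Y : E} (f : X ⟶ Y) (x : T ⟶ X) (y : T ⟶ Y) :
    lift x y ≫ mem (fiber f) = top T ↔ x ≫ f = y := by
  rw [fiber, mem_compr, graph, comp_χ_eq_top_iff]
  constructor
  · rintro ⟨k, h⟩
    have h₁ := congrArg (· ≫ fst _ _) h
    have h₂ := congrArg (· ≫ snd _ _) h
    simp at h₁ h₂
    rw [← h₁, h₂]
  · rintro rfl
    exact ⟨x, by simp⟩

/-- A valid falsum identifies all formulas. -/
lemma eq_top_of_bot_valid {Γ : E} (h : bot Γ = top Γ) (φ : Γ ⟶ Ω E) : φ = top Γ := by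
  -- Falsum is `∀ ω, ω`; instantiate `ω` at `φ`.
  have h' := congrArg (lift φ (𝟙 Γ) ≫ ·) ((all_valid_iff _).1 h)
  simpa using h'

variable [HasFiniteLimits E]

lemma not_valid_iff {Γ : E} (φ : Γ ⟶ Ω E) :
    not φ = top Γ ↔ ∀ ⦃T : E⦄ (t : T ⟶ Γ), t ≫ φ = top T → bot T = top T := by
  simp [not, imp_valid_iff]

lemma or_valid_of_left {Γ : E} {φ : Γ ⟶ Ω E} (h : φ = top Γ) (ψ : Γ ⟶ Ω E) :
    or φ ψ = top Γ := by
  subst h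
  unfold or
  rw [all_valid_iff, imp_valid_iff]
  intro T t ht
  rw [comp_and, and_valid_iff, comp_imp, imp_valid_iff] at ht
  simpa using ht.1 (𝟙 T) (by simp)

lemma or_valid_of_right {Γ : E} (φ : Γ ⟶ Ω E) {ψ : Γ ⟶ Ω E} (h : ψ = top Γ) :
    or φ ψ = top Γ := by
  subst h
  unfold or
  rw [all_valid_iff, imp_valid_iff]
  intro T t ht
  rw [comp_and, and_valid_iff, comp_imp, comp_imp, imp_valid_iff, imp_valid_iff] at ht
  simpa using ht.2 (𝟙 T) (by simp)

lemma valid_of_or_valid {Γ : E} {φ ψ θ : Γ ⟶ Ω E} (h : or φ ψ = top Γ)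
    (hφ : ∀ ⦃T : E⦄ (t : T ⟶ Γ), t ≫ φ = top T → t ≫ θ = top T)
    (hψ : ∀ ⦃T : E⦄ (t : T ⟶ Γ), t ≫ ψ = top T → t ≫ θ = top T) : θ = top Γ := by
  -- Disjunction elimination is the second-order encoding instantiated at `ω = θ`.
  have h₁ := (imp_valid_iff _ _).1 ((all_valid_iff _).1 h) (lift θ (𝟙 Γ))
  simp only [comp_and, comp_imp, lift_fst, lift_snd_assoc, Category.id_comp, and_valid_iff,
    imp_valid_iff] at h₁
  exact h₁ ⟨hφ, hψ⟩

lemma not_not_valid_of_valid {Γ : E} {φ : Γ ⟶ Ω E} (h : φ = top Γ) : not (not φ) = top Γ := by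
  rw [not_valid_iff]
  intro T t ht
  rw [comp_not, not_valid_iff] at ht
  simpa using ht (𝟙 T) (by simp [h])

/-- A decidable formula is `¬¬`-stable. -/
lemma not_not_eq_of_or_not_valid {Γ : E} {φ : Γ ⟶ Ω E} (h : or φ (not φ) = top Γ) :
    not (not φ) = φ := by
  refine formula_ext fun T t => ⟨fun ht => ?_, fun ht => ?_⟩
  · rw [comp_not, comp_not, not_valid_iff] at ht
    refine valid_of_or_valid (φ := t ≫ φ) (ψ := not (t ≫ φ)) ?_ (fun _ _ h => h) fun S s hs => ?_
    · rw [← comp_not, ← comp_or, h, comp_top]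
    · exact eq_top_of_bot_valid (ht s hs) _
  · rw [comp_not, comp_not]
    exact not_not_valid_of_valid ht

/-- Two formulas that agree on a dense part therefore have the same double negation, which gives
uniqueness of extensions in `isSheafFor_stableΩ`. -/
lemma not_not_and_eq_of_not_not_valid {Γ : E} {φ ψ : Γ ⟶ Ω E} (h : not (not ψ) = top Γ) :
    not (not (and φ ψ)) = not (not φ) := by
  refine formula_ext fun T t => ?_
  simp only [comp_not, comp_and]
  have h' : not (not (t ≫ ψ)) = top T := by
    rw [← comp_not, ← comp_not, h, comp_top]
  rw [not_valid_iff] at h'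
  rw [not_valid_iff, not_valid_iff]
  refine ⟨fun H S s hs => H s ?_, fun H S s hs => h' s ?_⟩
  · rw [comp_not, not_valid_iff] at hs ⊢
    intro R r hr
    simp only [comp_and, and_valid_iff] at hr
    exact hs r hr.1
  · rw [comp_not, not_valid_iff] at hs ⊢
    intro R r hr
    have : not ((r ≫ s) ≫ t ≫ φ) = top R := by
      rw [not_valid_iff]
      intro Q q hq
      have := hs (q ≫ r)
      simp only [Category.assoc] at hq hr
      refine this ?_
      simp only [comp_and, and_valid_iff, Category.assoc, hr, comp_top, hq, and_self]
    exact H (r ≫ s) (by rw [comp_not, this])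

end ClosedSemantics

/-! ### The sheaf of stable truth values -/

section Sheaf

variable {E : Type u} [Category.{v} E] [CartesianMonoidalCategory E] [HasSubobjectClassifier E]
  [MonoidalClosed E] [HasFiniteLimits E]

variable (E) in
/-- The object of `¬¬`-stable truth values. -/
noncomputable def stableΩ : E := equalizer (notNot E) (𝟙 (Ω E))

variable (E) in
/-- The inclusion of the `¬¬`-stable truth values in all truth values. -/
noncomputable def stableΩι : stableΩ E ⟶ Ω E := equalizer.ι _ _

instance : Mono (stableΩι E) := inferInstanceAs (Mono (equalizer.ι _ _))

lemma not_not_comp_stableΩι {Γ : E} (g : Γ ⟶ stableΩ E) :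
    not (not (g ≫ stableΩι E)) = g ≫ stableΩι E := by
  have h : stableΩι E ≫ notNot E = stableΩι E ≫ 𝟙 _ := equalizer.condition _ _
  rw [← comp_notNot, Category.assoc, h, Category.comp_id]

lemma exists_comp_stableΩι {Γ : E} {φ : Γ ⟶ Ω E} (h : not (not φ) = φ) :
    ∃ g, g ≫ stableΩι E = φ :=
  ⟨equalizer.lift φ (by simpa using h), equalizer.lift_ι _ _⟩

/-- Existence: extend the formula arbitrarily, then apply `¬¬`, which leaves its stable values on
`A` unchanged. Uniqueness: a stable formula is determined by its conjunction with the dense `χ m`.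
-/
lemma isSheafFor_stableΩ : IsSheafFor (notNot E) (stableΩ E) := by
  intro A B m _ hm a
  have hm' : not (not (χ m)) = top B := by rwa [IsDenseMono, comp_notNot] at hm
  obtain ⟨ψ, hψ⟩ := exists_extension_of_mono m (a ≫ stableΩι E)
  obtain ⟨g, hg⟩ : ∃ g, g ≫ stableΩι E = not (not ψ) := by
    refine exists_comp_stableΩι ?_
    have h (φ : B ⟶ Ω E) : not (not (not φ)) = not φ := by
      refine formula_ext fun T t => ?_
      simp only [comp_not]
      refine ⟨fun H => ?_, not_not_valid_of_valid⟩
      rw [not_valid_iff] at H ⊢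
      intro S s hs
      exact H s (by simpa using not_not_valid_of_valid hs)
    rw [h]
  refine ⟨g, ?_, fun g' hg' => ?_⟩
  · change m ≫ g = a
    rw [← cancel_mono (stableΩι E), Category.assoc, hg, comp_not, comp_not, hψ,
      not_not_comp_stableΩι]
  · have hand : and (g' ≫ stableΩι E) (χ m) = and ψ (χ m) := by
      refine formula_ext fun T t => ?_
      simp only [comp_and, and_valid_iff]
      refine and_congr_left fun ht => ?_
      obtain ⟨k, rfl⟩ := (comp_χ_eq_top_iff _ _).1 ht
      rw [Category.assoc, Category.assoc, hψ, ← hg', Category.assoc]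
    rw [← cancel_mono (stableΩι E), hg, ← not_not_comp_stableΩι,
      ← not_not_and_eq_of_not_not_valid hm', hand, not_not_and_eq_of_not_not_valid hm']

end Sheaf

/-! ### Global elements under NS and pneumoconnected fibers -/

section Pneumoconnected

variable {E : Type u} [Category.{v} E] [CartesianMonoidalCategory E] [HasSubobjectClassifier E]
  [MonoidalClosed E] [HasFiniteLimits E]

/-- Under NS, a formula holds at some global element unless its negation is valid. -/
lemma Nullstellensatz.exists_point_or_not_valid (hNS : Nullstellensatz E) {Γ : E} (φ : Γ ⟶ Ω E) :
    (∃ p : 𝟙_ E ⟶ Γ, p ≫ φ = top (𝟙_ E)) ∨ not φ = top Γ := by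
  obtain ⟨U, i, _, rfl⟩ : ∃ (U : E) (i : U ⟶ Γ) (_ : Mono i), φ = χ i :=
    Subobject.Classifier.surjective_χ _ φ
  obtain ⟨⟨hU⟩⟩ | ⟨⟨p⟩⟩ := hNS U
  · right
    rw [not_valid_iff]
    intro T t ht
    obtain ⟨k, rfl⟩ := (comp_χ_eq_top_iff _ _).1 ht
    rw [← comp_bot k, hU.hom_ext (bot U) (top U), comp_top]
  · exact Or.inl ⟨p ≫ i, (comp_χ_eq_top_iff _ _).2 ⟨p, rfl⟩⟩

/-- Under NS, a part of `X` given at a global element is empty or has a global element. -/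
lemma Nullstellensatz.eq_empty_valid_or_exists_mem (hNS : Nullstellensatz E) {Γ X : E}
    (u : Γ ⟶ power X) (p : 𝟙_ E ⟶ Γ) :
    p ≫ eq u (empty Γ X) = top (𝟙_ E) ∨ ∃ x : 𝟙_ E ⟶ X, lift x p ≫ mem u = top (𝟙_ E) := by
  obtain ⟨q, hq⟩ | h := hNS.exists_point_or_not_valid (X ◁ p ≫ mem u)
  · refine Or.inr ⟨q ≫ fst _ _, ?_⟩
    rw [← hq, ← Category.assoc]
    congr 1
    ext
    · simp
    · simp only [lift_snd, Category.assoc, whiskerLeft_snd]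
      rw [← Category.assoc, toUnit_unique (q ≫ snd _ _) (𝟙 _), Category.id_comp]
  · left
    rw [comp_eq, eq_valid_iff, ← compr_mem (p ≫ u), mem_comp, empty, comp_compr]
    congr 1
    rw [not_valid_iff] at h
    refine formula_ext fun T t => ⟨fun ht => ?_, fun ht => ?_⟩
    · simpa using h t ht
    · simp only [comp_bot] at ht
      exact eq_top_of_bot_valid ht _

/-- The equalizer condition defining `complPower`, read through membership. -/
lemma mem_complPowerι_or_not_valid (X : E) :
    or (mem (complPowerι X)) (not (mem (complPowerι X))) = top (X ⊗ complPower X) := by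
  have h : complPowerι X ≫ union (𝟙 (power X)) (compl (𝟙 (power X))) =
      complPowerι X ≫ whole (power X) X := equalizer.condition _ _
  have h' := congrArg mem h
  simpa [union, compl, whole, ← mem_comp] using h'

/-- Under NS, a map through which every `¬¬`-stable part of its domain factors has pneumoconnected
fibers. -/
lemma hasPneumoconnectedFibers_of_factors (hNS : Nullstellensatz E) {X Y : E} (f : X ⟶ Y)
    (hf : ∀ a : X ⟶ stableΩ E, ∃ g : Y ⟶ stableΩ E, f ≫ g = a) : HasPneumoconnectedFibers f := by
  dsimp only [HasPneumoconnectedFibers, UniversallyValid]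
  set v : Y ⊗ complPower X ⟶ power X := fst Y (complPower X) ≫ fiber f with hv
  set w : Y ⊗ complPower X ⟶ power X := snd Y (complPower X) ≫ complPowerι X with hw
  obtain ⟨p, hp⟩ | h := hNS.exists_point_or_not_valid
    (not (or (eq (inter v w) (empty _ X)) (eq (inter v (compl w)) (empty _ X))))
  · -- At a global element where the formula fails, both intersections would have global elements.
    have hbot : bot (𝟙_ E) = top (𝟙_ E) := by
      rw [comp_not, not_valid_iff] at hp
      have hmem (x : 𝟙_ E ⟶ X) (z : Y ⊗ complPower X ⟶ power X) :
          lift x p ≫ mem (inter v z) = top (𝟙_ E) ↔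
            x ≫ f = p ≫ fst _ _ ∧ lift x p ≫ mem z = top (𝟙_ E) := by
        rw [inter, mem_compr, comp_and, and_valid_iff, hv, mem_comp, ← Category.assoc,
          lift_whiskerLeft, lift_comp_mem_fiber_valid_iff]
      obtain h₀ | ⟨x₀, h₀⟩ := hNS.eq_empty_valid_or_exists_mem (inter v w) p
      · exact hp (𝟙 _) (by rw [Category.id_comp, comp_or, or_valid_of_left h₀])
      obtain h₁ | ⟨x₁, h₁⟩ := hNS.eq_empty_valid_or_exists_mem (inter v (compl w)) p
      · exact hp (𝟙 _) (by rw [Category.id_comp, comp_or, or_valid_of_right _ h₁])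
      rw [hmem] at h₀ h₁
      -- The part `w` at the parameter `p`, as a formula on `X` alone; this needs `p` to be a global
      -- element.
      let φ : X ⟶ Ω E := lift (𝟙 X) (toUnit X ≫ p) ≫ mem w
      have hφ : not (not φ) = φ := by
        refine not_not_eq_of_or_not_valid ?_
        have h := congrArg (lift (𝟙 X) (toUnit X ≫ p ≫ snd _ _) ≫ ·)
          (mem_complPowerι_or_not_valid X)
        simpa [φ, hw, mem_comp] using h
      have hx (x : 𝟙_ E ⟶ X) : x ≫ φ = lift x p ≫ mem w := by
        rw [← Category.assoc, comp_lift, Category.comp_id, ← Category.assoc,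
          toUnit_unique (x ≫ toUnit X) (𝟙 _), Category.id_comp]
      obtain ⟨a, ha⟩ := exists_comp_stableΩι hφ
      obtain ⟨g, rfl⟩ := hf a
      have hxx : x₁ ≫ φ = x₀ ≫ φ := by
        rw [← ha, Category.assoc, ← Category.assoc x₁, h₁.1, ← h₀.1]
        simp only [Category.assoc]
      have h₁' := h₁.2
      rw [compl, mem_compr, comp_not, ← hx, hxx, hx, not_valid_iff] at h₁'
      exact h₁' (𝟙 _) (by rw [Category.id_comp, h₀.2])
    -- Falsum valid over the terminal object is valid in every context, so the topos is degenerate.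
    refine eq_top_of_bot_valid ?_ _
    rw [← comp_bot (toUnit _), hbot, comp_top]
  · exact h

end Pneumoconnected

end Topos

/-- In an elementary topos that satisfies NS, the reflection of every object in the full subcategory
of `¬¬`-separated objects has pneumoconnected fibers, and so does its reflection in the full
subcategory of `¬¬`-sheaves. -/
theorem corollaryT {E : Type u} [Category.{v} E] [CartesianMonoidalCategory E] [MonoidalClosed E]
    [HasFiniteLimits E] [HasSubobjectClassifier E] (hNS : Topos.Nullstellensatz E) :
    (∀ (X M : E) (m : X ⟶ M), Topos.IsReflection (Topos.IsSeparatedFor (Topos.notNot E)) m →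
      Topos.HasPneumoconnectedFibers m) ∧
    (∀ (X S : E) (η : X ⟶ S), Topos.IsReflection (Topos.IsSheafFor (Topos.notNot E)) η →
      Topos.HasPneumoconnectedFibers η) := by
  refine ⟨fun X M m hm => ?_, fun X S η hη => ?_⟩
  · exact Topos.hasPneumoconnectedFibers_of_factors hNS m fun a =>
      (hm.2 (Topos.isSeparatedFor_of_isSheafFor Topos.isSheafFor_stableΩ) a).exists
  · exact Topos.hasPneumoconnectedFibers_of_factors hNS η fun a =>
      (hη.2 Topos.isSheafFor_stableΩ a).exists
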